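/- **Model.** Fix integers $n,m\ge 3$. The oriented $n\times m$ torus has node set $\mathbb Z_n\times\mathbb Z_m$; the four links at each node are consistently labelled North, East, South, West. Exactly one node $b$, the black hole, destroys every agent that enters it, leaving no trace. Initially $k$ identical agents are at pairwise distinct nodes different from $b$ (they are *scattered*), all in the same initial state, each carrying $t$ identical tokens; no node contains a token and no link is marked. All agents run the same deterministic finite Moore automaton (a finite state set $S$, an initial state, a transition function and an output function), which may depend on $k$ and $t$ but not on $n,m$. The system is synchronous; in each time unit every surviving agent executes the output of its current state: it (1) releases some number of the tokens that it carries at its current node (tokens are *unmovable*: once released they stay at that node forever), then (2) may mark one link at its node as dangerous, which permanently disables this link for all agents, then (3) stays, or moves along one of the four links (it stays if that link is disabled). After the simultaneous moves, each surviving agent perceives the direction of its last move (or "none" if it did not move), the number of tokens at its node, the number of tokens that it still carries, and whether at least one other agent is at its node, and it changes its state according to its transition function. The search *succeeds* if at some finite time the links marked as dangerous are exactly the four links incident to the black hole and at least one agent survives. An automaton *solves black hole search in all oriented tori with $k$ scattered agents and $t$ unmovable tokens per agent* if the search succeeds for all $n,m\ge 3$, all pairwise distinct starting nodes of the $k$ agents,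 and all positions of the black hole at a node that is not a starting node. **Theorem.** For all non-negative integers $k$ and $t$ there is no finite automaton that solves black hole search in all oriented tori with $k$ scattered agents having $t$ unmovable tokens each. -/

import Mathlib

/-! Synchronous oriented tori with a black hole, searched by identical finite automata that carry
identical unmovable tokens. -/

namespace BlackHole

/-- The four consistently oriented port labels of a torus. -/
inductive Dir
  | north
  | east
  | south
  | west
  deriving DecidableEq

/-- The nodes of the `n × m` torus (used for `3 ≤ n`, `3 ≤ m`). -/
abbrev Node (n m : ℕ) : Type := ZMod n × ZMod m

/-- The neighbour of a node in a given direction. -/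
def Node.next {n m : ℕ} (v : Node n m) : Dir → Node n m
  | Dir.north => (v.1, v.2 + 1)
  | Dir.east => (v.1 + 1, v.2)
  | Dir.south => (v.1, v.2 - 1)
  | Dir.west => (v.1 - 1, v.2)

/-- The (undirected) link that leaves `v` in direction `d`. -/
def Node.link {n m : ℕ} (v : Node n m) (d : Dir) : Sym2 (Node n m) := s(v, v.next d)

/-- The links incident to `v`. -/
def Node.incidentLinks {n m : ℕ} (v : Node n m) : Finset (Sym2 (Node n m)) :=
  {v.link Dir.north, v.link Dir.east, v.link Dir.south, v.link Dir.west}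

/-- What an agent perceives at a node: the direction of the move by which it has just arrived
(`none` if it has not moved), the number of tokens at the node, the number of tokens that it still
carries, and whether at least one other agent is at the node. With `k` agents having `t` tokens
each only token counts up to `k * t` and `t` occur. -/
structure Percept where
  arrival : Option Dir
  tokensHere : ℕ
  tokensCarried : ℕ
  company : Bool

/-- What an agent does in one time unit: release `put` tokens at its node (all the tokens it
carries if it carries fewer), then mark the link in direction `mark` as dangerous (if any), then
move in direction `move` (stay if `none`). As tokens are unmovable, there is no command for picking
tokens up. -/
structure Command where
  put : ℕ
  mark : Option Dir
  move : Option Dir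

/-- The algorithm of an agent, a Moore automaton with state set `S`. -/
structure Automaton (S : Type*) where
  /-- initial state -/
  init : S
  /-- transition function -/
  trans : S → Percept → S
  /-- output function -/
  out : S → Command

/-- The data of a surviving agent. -/
structure AgentStatus (n m : ℕ) (S : Type*) where
  pos : Node n m
  state : S
  carried : ℕ

/-- A global configuration of `k` agents on the `n × m` torus. Destroyed agents have status
`none`. -/
structure Config (n m k : ℕ) (S : Type*) where
  agents : Fin k → Option (AgentStatus n m S)
  tokens : Node n m → ℕ
  marked : Finset (Sym2 (Node n m))

namespace Automaton

variable {n m k : ℕ} {S : Type*}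

/-- The number of tokens that an agent releases in the current time unit. -/
def released (A : Automaton S) (a : AgentStatus n m S) : ℕ :=
  min (A.out a.state).put a.carried

/-- The tokens at each node after the agents have released tokens. -/
def newTokens (A : Automaton S) (c : Config n m k S) (v : Node n m) : ℕ :=
  c.tokens v + ∑ i : Fin k,
    match c.agents i with
    | none => 0
    | some a => if a.pos = v then A.released a else 0

/-- The links marked as dangerous after the agents have marked links. Marks are permanent. -/
def newMarked (A : Automaton S) (c : Config n m k S) : Finset (Sym2 (Node n m)) :=
  c.marked ∪ Finset.univ.biUnion fun i : Fin k =>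
    match c.agents i with
    | none => ∅
    | some a =>
      match (A.out a.state).mark with
      | none => ∅
      | some d => {a.pos.link d}

/-- The move that an agent actually performs; links marked as dangerous are disabled. -/
def actualMove (A : Automaton S) (c : Config n m k S) (a : AgentStatus n m S) : Option Dir :=
  match (A.out a.state).move with
  | none => none
  | some d => if a.pos.link d ∈ A.newMarked c then none else some d

/-- The position of an agent after its move. -/
def newPos (A : Automaton S) (c : Config n m k S) (a : AgentStatus n m S) : Node n m :=
  match A.actualMove c a with
  | none => a.pos
  | some d => a.pos.next d

/-- Whether, after the moves, some agent other than `i` is at the node `v`. -/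
def othersAt (A : Automaton S) (c : Config n m k S) (i : Fin k) (v : Node n m) : Bool :=
  decide (∃ j : Fin k, j ≠ i ∧ (c.agents j).map (A.newPos c) = some v)

/-- The status of agent `i` after one time unit, when its status before was `a` and the black hole
is at `b`: the agent is destroyed if it has moved to `b`, and otherwise it changes its state
according to what it perceives at the node that it has reached. -/
def newStatus (A : Automaton S) (b : Node n m) (c : Config n m k S) (i : Fin k)
    (a : AgentStatus n m S) : Option (AgentStatus n m S) :=
  if A.newPos c a = b then none
  else some
    { pos := A.newPos c a
      state := A.trans a.state
        { arrival := A.actualMove c a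
          tokensHere := A.newTokens c (A.newPos c a)
          tokensCarried := a.carried - A.released a
          company := A.othersAt c i (A.newPos c a) }
      carried := a.carried - A.released a }

/-- One synchronous time unit: all surviving agents release tokens, then mark links, then move,
and then perceive their new nodes. -/
def step (A : Automaton S) (b : Node n m) (c : Config n m k S) : Config n m k S where
  agents i := (c.agents i).bind (A.newStatus b c i)
  tokens := A.newTokens c
  marked := A.newMarked c

/-- The initial configuration: each agent is at its starting node in the initial state and carries
`t` tokens; no node contains a token and no link is marked. -/
def start (A : Automaton S) (t : ℕ) (s : Fin k → Node n m) : Config n m k S where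
  agents i := some { pos := s i, state := A.init, carried := t }
  tokens _ := 0
  marked := ∅

/-- The configuration after `T` time units, with the black hole at `b`. -/
def run (A : Automaton S) (t : ℕ) (s : Fin k → Node n m) (b : Node n m) (T : ℕ) :
    Config n m k S :=
  (A.step b)^[T] (A.start t s)

/-- The search succeeds: after finitely many time units all links incident to the black hole, and
only those links, are marked as dangerous, and at least one agent survives. -/
def Succeeds (A : Automaton S) (t : ℕ) (s : Fin k → Node n m) (b : Node n m) : Prop :=
  ∃ T : ℕ, (A.run t s b T).marked = b.incidentLinks ∧
    ∃ i : Fin k, (A.run t s b T).agents i ≠ none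

/-- The algorithm solves black hole search in all oriented tori with `k` scattered agents having
`t` unmovable tokens each: it succeeds for all sizes `n × m` with `n, m ≥ 3`, all pairwise distinct
starting nodes of the agents, and all positions of the black hole off the starting nodes. -/
def SolvesBHS (A : Automaton S) (k t : ℕ) : Prop :=
  ∀ n m : ℕ, 3 ≤ n → 3 ≤ m → ∀ s : Fin k → Node n m, Function.Injective s →
    ∀ b : Node n m, (∀ i, s i ≠ b) → A.Succeeds t s b

end Automaton

end BlackHole

namespace BlackHole

/-! Symmetry reduces `k` agents to one. Start them on the fibre of the origin under the covering of
the `N × N` torus by the `N × (k * N)` torus. Being identical and deterministic, they remain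
translates of each other, so as long as nobody marks a link or dies, they never meet, and each one
behaves like a lone agent on the `N × N` torus (`isLift_step`). The lone agent sees only linearly
many nodes (`exists_visited`). It drops tokens at boundedly many nodes, and away from tokens it is
an autonomous finite automaton whose walk on the torus closes up within `O(N)` steps. For large `N`
some node is thus neither visited nor adjacent to a visited node (`exists_remote_node`). With the
black hole above that node, no mark leaves the search unfinished, and the first mark is wrong
forever (`isLift_run_or_wrong_mark`). -/

/-- The unit vector of a direction. -/
def Dir.vec {n m : ℕ} : Dir → Node n m
  | Dir.north => (0, 1)
  | Dir.east => (1, 0)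
  | Dir.south => (0, -1)
  | Dir.west => (-1, 0)

theorem Node.next_eq_add_vec {n m : ℕ} (v : Node n m) (d : Dir) : v.next d = v + d.vec := by
  cases d <;> simp [Node.next, Dir.vec, sub_eq_add_neg, Prod.ext_iff]

/-- The displacement of an optional move. -/
def moveVec {n m : ℕ} : Option Dir → Node n m
  | none => 0
  | some d => d.vec

theorem Node.mem_of_mem_incidentLinks {n m : ℕ} {b : Node n m} {l : Sym2 (Node n m)}
    (h : l ∈ b.incidentLinks) : b ∈ l := by
  simp only [Node.incidentLinks, Node.link, Finset.mem_insert, Finset.mem_singleton] at h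
  rcases h with rfl | rfl | rfl | rfl <;> simp

/-! ### Skew products over a finite dynamical system -/

section Skew

variable {G Q : Type*} [AddCommGroup G] (δ : Q → G) (f : Q → Q)

/-- The movement of an automaton with autonomous states. -/
def skew (y : G × Q) : G × Q := (y.1 + δ y.2, f y.2)

/-- The states evolve independently of the position, so the walk commutes with translations. -/
theorem skew_iterate (j : ℕ) (x : G) (q : Q) :
    (skew δ f)^[j] (x, q) = (x + ((skew δ f)^[j] (0, q)).1, f^[j] q) := by
  induction j with
  | zero => simp
  | succ j ih =>
    rw [Function.iterate_succ_apply', Function.iterate_succ_apply', ih,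
      Function.iterate_succ_apply']
    have h2 : ((skew δ f)^[j] (0, q)).2 = f^[j] q := by
      have : ∀ i, ((skew δ f)^[i] (0, q)).2 = f^[i] q := by
        intro i
        induction i with
        | zero => rfl
        | succ i ihi => rw [Function.iterate_succ_apply', Function.iterate_succ_apply', ← ihi]; rfl
      exact this j
    simp [skew, h2, add_assoc]

/-- Each state period adds the same displacement, and `N` copies of it cancel. -/
theorem isPeriodicPt_skew {p N : ℕ} (hN : ∀ g : G, N • g = 0) {q : Q}
    (hq : f^[p] q = q) (x : G) : Function.IsPeriodicPt (skew δ f) (p * N) (x, q) := by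
  have h : ∀ i : ℕ, ((skew δ f)^[p])^[i] (x, q)
      = (x + i • ((skew δ f)^[p] (0, q)).1, q) := by
    intro i
    induction i with
    | zero => simp
    | succ i ih =>
      rw [Function.iterate_succ_apply', ih, skew_iterate, hq, succ_nsmul, add_assoc]
  rw [Function.IsPeriodicPt, Function.IsFixedPt, Function.iterate_mul, h, hN, add_zero]

theorem skew_iterate_reduce {a p N : ℕ} (hp : 0 < p) (hN0 : 0 < N) (hN : ∀ g : G, N • g = 0)
    (hf : f^[a + p] = f^[a]) (y : G × Q) (j : ℕ) :
    ∃ i < a + p * N, (skew δ f)^[j] y = (skew δ f)^[i] y := by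
  have hpN : 0 < p * N := Nat.mul_pos hp hN0
  rcases lt_or_ge j a with h | h
  · exact ⟨j, by omega, rfl⟩
  · obtain ⟨x, q⟩ := y
    have hper : Function.IsPeriodicPt (skew δ f) (p * N) ((skew δ f)^[a] (x, q)) := by
      rw [skew_iterate]
      apply isPeriodicPt_skew δ f hN
      rw [← Function.iterate_add_apply, add_comm p a, hf]
    refine ⟨(j - a) % (p * N) + a, ?_, ?_⟩
    · have := Nat.mod_lt (j - a) hpN
      omega
    · rw [Function.iterate_add_apply, hper.iterate_mod_apply, ← Function.iterate_add_apply,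
        Nat.sub_add_cancel h]

end Skew

theorem exists_iterate_add_eq {Q : Type*} [Finite Q] (f : Q → Q) :
    ∃ a p : ℕ, 0 < p ∧ f^[a + p] = f^[a] := by
  obtain ⟨i, j, hij, h⟩ := Finite.exists_ne_map_eq_of_infinite (fun i : ℕ => f^[i])
  rcases lt_or_gt_of_ne hij with h' | h'
  · exact ⟨i, j - i, by omega, by rw [Nat.add_sub_cancel' h'.le]; exact h.symm⟩
  · exact ⟨j, i - j, by omega, by rw [Nat.add_sub_cancel' h'.le]; exact h⟩

/-! ### A lone agent on a torus without black hole and marks -/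

/-- The configuration of a lone agent that carries at most `t` tokens. -/
structure Solo (N t : ℕ) (S : Type*) where
  pos : Node N N
  state : S × Fin (t + 1)
  tok : Node N N → ℕ

namespace Automaton

variable {S : Type*} {t : ℕ} (A : Automaton S)

/-- The number of tokens released in an internal state. -/
def drop (q : S × Fin (t + 1)) : ℕ := min (A.out q.1).put q.2

/-- The internal state after a time unit in which `h` tokens are perceived. -/
def nextState (q : S × Fin (t + 1)) (h : ℕ) : S × Fin (t + 1) :=
  (A.trans q.1 ⟨(A.out q.1).move, h, q.2 - A.drop q, false⟩, ⟨q.2 - A.drop q, by omega⟩)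

/-- The internal state after a time unit in which no token is perceived. -/
def blankState (q : S × Fin (t + 1)) : S × Fin (t + 1) := A.nextState q 0

/-- The displacement in an internal state. -/
def shift {N : ℕ} (q : S × Fin (t + 1)) : Node N N := moveVec (A.out q.1).move

variable {N : ℕ}

/-- The tokens after the lone agent has released tokens. -/
def soloTok (x : Solo N t S) (v : Node N N) : ℕ :=
  x.tok v + if x.pos = v then A.drop x.state else 0

/-- One time unit of the lone agent. -/
def soloStep (x : Solo N t S) : Solo N t S where
  pos := x.pos + A.shift x.state
  state := A.nextState x.state (A.soloTok x (x.pos + A.shift x.state))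
  tok := A.soloTok x

/-- The lone agent after `T` time units. -/
def soloRun (N t : ℕ) (T : ℕ) : Solo N t S :=
  A.soloStep^[T] ⟨0, (A.init, Fin.last t), fun _ => 0⟩

theorem soloRun_succ (T : ℕ) : A.soloRun N t (T + 1) = A.soloStep (A.soloRun N t T) :=
  Function.iterate_succ_apply' _ _ _

/-- The times at which the lone agent releases tokens. -/
def dropTimes (N t : ℕ) : Set ℕ := {T | A.drop (A.soloRun N t T).state ≠ 0}

theorem carried_lt_of_mem_dropTimes {T T' : ℕ} (hT : T ∈ A.dropTimes N t) (h : T < T') :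
    (A.soloRun N t T').state.2 < (A.soloRun N t T).state.2 := by
  induction T', h using Nat.le_induction with
  | base =>
    rw [soloRun_succ, Fin.lt_def]
    have h1 : A.drop (A.soloRun N t T).state ≠ 0 := hT
    have h2 : A.drop (A.soloRun N t T).state ≤ (A.soloRun N t T).state.2 := min_le_right _ _
    simp only [soloStep, nextState]
    omega
  | succ T' _ ih =>
    refine lt_of_le_of_lt ?_ ih
    rw [soloRun_succ, Fin.le_def]
    simp only [soloStep, nextState]
    omega

theorem injOn_carried_dropTimes :
    Set.InjOn (fun T => (A.soloRun N t T).state.2) (A.dropTimes N t) := by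
  intro T hT T' hT' h
  rcases lt_trichotomy T T' with hlt | heq | hlt
  · exact absurd h.symm (A.carried_lt_of_mem_dropTimes hT hlt).ne
  · exact heq
  · exact absurd h (A.carried_lt_of_mem_dropTimes hT' hlt).ne

theorem finite_dropTimes : (A.dropTimes N t).Finite :=
  Set.Finite.of_finite_image (Set.toFinite _) A.injOn_carried_dropTimes

theorem card_dropTimes_le : (A.finite_dropTimes (N := N) (t := t)).toFinset.card ≤ t + 1 := by
  have h := Finset.card_le_card_of_injOn (s := (A.finite_dropTimes (N := N) (t := t)).toFinset)
    (t := (Finset.univ : Finset (Fin (t + 1)))) (fun T => (A.soloRun N t T).state.2)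
    (fun _ _ => Finset.mem_coe.2 (Finset.mem_univ _))
    (by simpa using A.injOn_carried_dropTimes)
  simpa using h

/-- The starting node and the nodes at which the lone agent releases tokens. -/
noncomputable def landmarks (N t : ℕ) : Finset (Node N N) :=
  insert 0 ((A.finite_dropTimes (N := N) (t := t)).toFinset.image fun T => (A.soloRun N t T).pos)

theorem card_landmarks_le : (A.landmarks N t).card ≤ t + 2 :=
  (Finset.card_insert_le _ _).trans
    (Nat.succ_le_succ (Finset.card_image_le.trans A.card_dropTimes_le))

theorem mem_landmarks_of_tok_ne_zero (T : ℕ) (v : Node N N) (h : (A.soloRun N t T).tok v ≠ 0) :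
    v ∈ A.landmarks N t := by
  induction T with
  | zero => exact absurd rfl h
  | succ T ih =>
    by_cases h0 : (A.soloRun N t T).tok v = 0
    · rw [soloRun_succ] at h
      simp only [soloStep, soloTok, h0, zero_add, ne_eq, ite_eq_right_iff, not_forall] at h
      obtain ⟨rfl, h⟩ := h
      refine Finset.mem_insert_of_mem (Finset.mem_image.2 ⟨T, ?_, rfl⟩)
      simpa [dropTimes] using h
    · exact ih h0

/-- A flight restarts whenever a token is perceived, which happens only at a landmark; in between
the state follows `blankState`. -/
theorem exists_flight (T : ℕ) : ∃ v ∈ A.landmarks N t, ∃ (q : S × Fin (t + 1)) (j : ℕ),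
    ((A.soloRun N t T).pos, (A.soloRun N t T).state)
      = (skew A.shift A.blankState)^[j] (v, q) := by
  induction T with
  | zero => exact ⟨0, Finset.mem_insert_self _ _, (A.init, Fin.last t), 0, rfl⟩
  | succ T ih =>
    by_cases h0 : (A.soloRun N t (T + 1)).tok (A.soloRun N t (T + 1)).pos = 0
    · obtain ⟨v, hv, q, j, h⟩ := ih
      refine ⟨v, hv, q, j + 1, ?_⟩
      rw [Function.iterate_succ_apply', ← h]
      rw [soloRun_succ] at h0 ⊢
      have h0' : A.soloTok (A.soloRun N t T)
        ((A.soloRun N t T).pos + A.shift (A.soloRun N t T).state) = 0 := h0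
      simp only [soloStep, h0']
      rfl
    · exact ⟨_, A.mem_landmarks_of_tok_ne_zero _ _ h0, _, 0, rfl⟩

/-- The lone agent visits at most linearly many nodes. -/
theorem exists_visited [Finite S] (t : ℕ) : ∃ C : ℕ, ∀ N : ℕ, 0 < N →
    ∃ V : Finset (Node N N), V.card ≤ C * N ∧ ∀ T, (A.soloRun N t T).pos ∈ V := by
  classical
  have := Fintype.ofFinite S
  obtain ⟨a, p, hp, hf⟩ := exists_iterate_add_eq (A.blankState (t := t))
  -- The factors count landmarks, internal states at the start of a flight, and steps until it
  -- repeats: `a + p * N ≤ (a + p) * N`.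
  refine ⟨(t + 2) * (Fintype.card (S × Fin (t + 1)) * (a + p)), fun N hN => ?_⟩
  refine ⟨(A.landmarks N t ×ˢ ((Finset.univ : Finset (S × Fin (t + 1))) ×ˢ
    Finset.range (a + p * N))).image
      fun y => ((skew A.shift A.blankState)^[y.2.2] (y.1, y.2.1)).1, ?_, fun T => ?_⟩
  · refine Finset.card_image_le.trans ?_
    rw [Finset.card_product, Finset.card_product, Finset.card_range, Finset.card_univ,
      mul_assoc, mul_assoc]
    gcongr
    · exact A.card_landmarks_le
    · nlinarith [Nat.le_mul_of_pos_right a hN]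
  · obtain ⟨v, hv, q, j, h⟩ := A.exists_flight (N := N) (t := t) T
    obtain ⟨i, hi, hij⟩ := skew_iterate_reduce A.shift A.blankState hp hN
      (fun g : Node N N => by ext <;> simp) hf (v, q) j
    refine Finset.mem_image.2 ⟨(v, q, i), ?_, ?_⟩
    · simp [hv, hi]
    · simp only [← hij, ← h]

/-- The lone agent keeps away from some node. -/
theorem exists_remote_node [Finite S] (t : ℕ) : ∃ N : ℕ, 3 ≤ N ∧ ∃ b : Node N N,
    ∀ T, b ≠ (A.soloRun N t T).pos ∧ ∀ d, b ≠ (A.soloRun N t T).pos.next d := by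
  obtain ⟨C, hC⟩ := A.exists_visited t
  -- The visited nodes and their neighbours number at most `5 * C * N`, which is less than `N * N`
  -- once `N > 5 * C`.
  refine ⟨5 * C + 3, by omega, ?_⟩
  obtain ⟨V, hV, hmem⟩ := hC (5 * C + 3) (by omega)
  have : NeZero (5 * C + 3) := ⟨by omega⟩
  set W : Finset (Node (5 * C + 3) (5 * C + 3)) :=
    V ∪ (V.image (·.next Dir.north) ∪ (V.image (·.next Dir.east) ∪
      (V.image (·.next Dir.south) ∪ V.image (·.next Dir.west)))) with hW
  have hcard : W.card < Fintype.card (Node (5 * C + 3) (5 * C + 3)) := by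
    have h : W.card ≤ 5 * V.card := by
      have h1 := fun d : Dir => Finset.card_image_le (s := V) (f := (·.next d))
      have hn := h1 Dir.north
      have he := h1 Dir.east
      have hs := h1 Dir.south
      have hw := h1 Dir.west
      refine (Finset.card_union_le _ _).trans ?_
      have u1 := Finset.card_union_le (V.image (·.next Dir.north)) (V.image (·.next Dir.east) ∪
        (V.image (·.next Dir.south) ∪ V.image (·.next Dir.west)))
      have u2 := Finset.card_union_le (V.image (·.next Dir.east))
        (V.image (·.next Dir.south) ∪ V.image (·.next Dir.west))
      have u3 := Finset.card_union_le (V.image (·.next Dir.south)) (V.image (·.next Dir.west))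
      omega
    rw [Fintype.card_prod, ZMod.card]
    nlinarith
  obtain ⟨b, -, hb⟩ :=
    Finset.exists_mem_notMem_of_card_lt_card (hcard.trans_eq Finset.card_univ.symm)
  refine ⟨b, fun T => ⟨?_, fun d => ?_⟩⟩
  · rintro rfl
    exact hb (Finset.mem_union_left _ (hmem T))
  · rintro rfl
    apply hb
    have := Finset.mem_image_of_mem (·.next d) (hmem T)
    cases d <;> simp only [hW, Finset.mem_union] <;> tauto

end Automaton

/-! ### Symmetric placements -/

/-- The covering of the `N × N` torus by the `N × (k * N)` torus. -/
def cover (N k : ℕ) : Node N (k * N) →+ Node N N :=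
  AddMonoidHom.prodMap (AddMonoidHom.id _)
    (ZMod.castHom (dvd_mul_left N k) (ZMod N)).toAddMonoidHom

theorem cover_vec {N k : ℕ} (d : Dir) : cover N k d.vec = d.vec := by
  cases d <;> simp [cover, Dir.vec]

theorem cover_next {N k : ℕ} (v : Node N (k * N)) (d : Dir) :
    cover N k (v.next d) = (cover N k v).next d := by
  rw [Node.next_eq_add_vec, Node.next_eq_add_vec, map_add, cover_vec]

theorem cover_moveVec {N k : ℕ} (o : Option Dir) : cover N k (moveVec o) = moveVec o := by
  cases o
  · exact map_zero _
  · exact cover_vec _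

theorem cover_surjective {N k : ℕ} : Function.Surjective (cover N k) := by
  rintro ⟨x, y⟩
  obtain ⟨z, hz⟩ := ZMod.castHom_surjective (dvd_mul_left N k) y
  exact ⟨(x, z), Prod.ext rfl hz⟩

/-- The nodes that cover the origin. -/
def fibre (N k : ℕ) (i : Fin k) : Node N (k * N) := (0, ((i * N : ℕ) : ZMod (k * N)))

theorem cover_fibre {N k : ℕ} (i : Fin k) : cover N k (fibre N k i) = 0 := by
  simp [cover, fibre]

theorem fibre_injective {N k : ℕ} (hN : 0 < N) : Function.Injective (fibre N k) := by
  intro i j h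
  have h2 := congrArg (fun v : Node N (k * N) => v.2.val) h
  simp only [fibre] at h2
  rw [ZMod.val_natCast_of_lt (Nat.mul_lt_mul_of_pos_right i.2 hN),
    ZMod.val_natCast_of_lt (Nat.mul_lt_mul_of_pos_right j.2 hN)] at h2
  exact Fin.ext (Nat.eq_of_mul_eq_mul_right hN h2)

theorem exists_fibre_of_cover_eq_zero {N k : ℕ} (hN : 0 < N) (hk : 0 < k) {w : Node N (k * N)}
    (h : cover N k w = 0) : ∃ i, fibre N k i = w := by
  have : NeZero (k * N) := ⟨(Nat.mul_pos hk hN).ne'⟩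
  obtain ⟨x, y⟩ := w
  have hx : x = 0 := congrArg Prod.fst h
  have hy : ((y.val : ℕ) : ZMod N) = 0 := by
    have h2 : ZMod.castHom (dvd_mul_left N k) (ZMod N) y = 0 := congrArg Prod.snd h
    rwa [← ZMod.natCast_zmod_val y, map_natCast] at h2
  rw [ZMod.natCast_eq_zero_iff] at hy
  obtain ⟨c, hc⟩ := hy
  have hlt : N * c < k * N := hc ▸ ZMod.val_lt y
  refine ⟨⟨c, lt_of_mul_lt_mul_left (by rwa [mul_comm k N] at hlt) N.zero_le⟩, ?_⟩
  refine Prod.ext hx.symm ?_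
  simp only [fibre]
  rw [mul_comm c N, ← hc, ZMod.natCast_zmod_val]

/-- The fibre is exactly the kernel of the covering, listed without repetition, so at most one
translate hits `v`. Hence the tokens released by all agents are the lift of those released by the
lone agent. -/
theorem sum_fibre {N k : ℕ} (hN : 0 < N) (hk : 0 < k) (q v : Node N (k * N)) (r : ℕ) :
    (∑ i : Fin k, if q + fibre N k i = v then r else 0)
      = if cover N k q = cover N k v then r else 0 := by
  split_ifs with h
  · obtain ⟨i, hi⟩ := exists_fibre_of_cover_eq_zero hN hk (w := v - q)
      (by rw [map_sub, h, sub_self])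
    have hiff : ∀ j, q + fibre N k j = v ↔ i = j := fun j => by
      rw [← eq_sub_iff_add_eq', ← hi, (fibre_injective hN).eq_iff, eq_comm]
    simp [hiff]
  · refine Finset.sum_eq_zero fun i _ => if_neg ?_
    rintro rfl
    exact h (by rw [map_add, cover_fibre, add_zero])

/-! ### Lifting the lone run to `k` agents, and the contradiction -/

namespace Automaton

variable {S : Type*} {t N k : ℕ} (A : Automaton S)

/-- Without marks, the configuration `c` consists of `k` shifted copies of `x`. -/
structure IsLift (x : Solo N t S) (c : Config N (k * N) k S) : Prop where
  agents : ∃ q, cover N k q = x.pos ∧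
    ∀ i, c.agents i = some ⟨q + fibre N k i, x.state.1, x.state.2⟩
  tokens : ∀ v, c.tokens v = x.tok (cover N k v)
  marked : c.marked = ∅

theorem isLift_start :
    IsLift (A.soloRun N t 0) (A.start t (fibre N k) : Config N (k * N) k S) where
  agents := ⟨0, map_zero _, fun i => by rw [zero_add]; rfl⟩
  tokens _ := rfl
  marked := rfl

theorem isLift_step (hN : 0 < N) (hk : 0 < k) {x : Solo N t S} {c : Config N (k * N) k S}
    (h : IsLift x c) (hmark : (A.out x.state.1).mark = none) {b : Node N (k * N)}
    (hb : cover N k b ≠ (A.soloStep x).pos) : IsLift (A.soloStep x) (A.step b c) := by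
  obtain ⟨q, hq, hag⟩ := h.agents
  have hmk : A.newMarked c = ∅ := by
    simp only [newMarked, h.marked, hag, hmark, Finset.empty_union]
    ext
    simp
  have htok : ∀ v, A.newTokens c v = A.soloTok x (cover N k v) := fun v => by
    simp only [newTokens, hag, h.tokens, soloTok, released]
    rw [sum_fibre hN hk, hq]
    rfl
  have hmove : ∀ v, A.actualMove c ⟨v, x.state.1, x.state.2⟩ = (A.out x.state.1).move := fun v => by
    simp only [actualMove, hmk, Finset.notMem_empty, if_false]
    cases (A.out x.state.1).move <;> rfl
  have hpos : ∀ v, A.newPos c ⟨v, x.state.1, x.state.2⟩ = v + moveVec (A.out x.state.1).move :=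
    fun v => by
      simp only [newPos, hmove]
      cases (A.out x.state.1).move
      · exact (add_zero v).symm
      · exact Node.next_eq_add_vec _ _
  have hcov : ∀ i, cover N k (q + fibre N k i + moveVec (A.out x.state.1).move)
      = x.pos + A.shift x.state := fun i => by
    rw [map_add, map_add, cover_fibre, add_zero, hq, cover_moveVec]
    rfl
  have hother : ∀ i, A.othersAt c i (q + fibre N k i + moveVec (A.out x.state.1).move) = false :=
    fun i => by
      simp only [othersAt, hag, Option.map_some, hpos, decide_eq_false_iff_not, Option.some.injEq,
        add_left_inj, add_right_inj]
      rintro ⟨j, hj, hji⟩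
      exact hj (fibre_injective hN hji)
  refine ⟨⟨q + moveVec (A.out x.state.1).move, ?_, fun i => ?_⟩, htok, hmk⟩
  · rw [map_add, hq, cover_moveVec]
    rfl
  · have hne : q + fibre N k i + moveVec (A.out x.state.1).move ≠ b := by
      rintro rfl
      exact hb (hcov i)
    simp only [step, hag, Option.bind_some, newStatus, hpos, hmove, if_neg hne, htok, hcov, hother]
    rw [add_right_comm]
    rfl

theorem marked_subset_step {n m : ℕ} (b : Node n m) (c : Config n m k S) :
    c.marked ⊆ (A.step b c).marked := Finset.subset_union_left

theorem link_mem_marked_step {n m : ℕ} (b : Node n m) (c : Config n m k S) {i : Fin k}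
    {a : AgentStatus n m S} {d : Dir} (ha : c.agents i = some a)
    (hd : (A.out a.state).mark = some d) : a.pos.link d ∈ (A.step b c).marked := by
  refine Finset.mem_union_right _ (Finset.mem_biUnion.2 ⟨i, Finset.mem_univ _, ?_⟩)
  simp [ha, hd]

/-- The lift may break at the first mark, since marks disable links; but that mark is already wrong
and permanent, so nothing later matters. -/
theorem isLift_run_or_wrong_mark (hN : 0 < N) (hk : 0 < k) {b : Node N (k * N)}
    (hb : ∀ T, cover N k b ≠ (A.soloRun N t T).pos ∧
      ∀ d, cover N k b ≠ (A.soloRun N t T).pos.next d) (T : ℕ) :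
    IsLift (A.soloRun N t T) (A.run t (fibre N k) b T) ∨
      ∃ l ∈ (A.run t (fibre N k) b T).marked, b ∉ l := by
  induction T with
  | zero => exact Or.inl A.isLift_start
  | succ T ih =>
    have hrun : A.run t (fibre N k) b (T + 1) = A.step b (A.run t (fibre N k) b T) :=
      Function.iterate_succ_apply' _ _ _
    rw [hrun]
    rcases ih with h | ⟨l, hl, hbl⟩
    · cases hm : (A.out (A.soloRun N t T).state.1).mark with
      | none =>
        left
        rw [soloRun_succ]
        refine A.isLift_step hN hk h hm ?_
        rw [← soloRun_succ]
        exact (hb (T + 1)).1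
      | some d =>
        right
        obtain ⟨q, hq, hag⟩ := h.agents
        refine ⟨_, A.link_mem_marked_step b _ (hag ⟨0, hk⟩) hm, ?_⟩
        -- Both ends of the marked link lie above the lone agent's node or a neighbour of it, and
        -- `b` lies above neither.
        have hcov : cover N k (q + fibre N k ⟨0, hk⟩) = (A.soloRun N t T).pos := by
          rw [map_add, cover_fibre, add_zero, hq]
        simp only [Node.link, Sym2.mem_iff, not_or]
        constructor
        · intro h'
          exact (hb T).1 (by rw [h', hcov])
        · intro h'
          exact (hb T).2 d (by rw [h', cover_next, hcov])
    · exact Or.inr ⟨l, A.marked_subset_step _ _ hl, hbl⟩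

theorem not_solvesBHS [Finite S] (k t : ℕ) : ¬ A.SolvesBHS k t := by
  intro hA
  -- Without agents there is no survivor, which success requires.
  rcases Nat.eq_zero_or_pos k with rfl | hk
  · obtain ⟨-, -, i, -⟩ := hA 3 3 le_rfl le_rfl (fun i => i.elim0) (fun i => i.elim0) 0
      (fun i => i.elim0)
    exact i.elim0
  obtain ⟨N, hN3, b₀, hb₀⟩ := A.exists_remote_node t
  obtain ⟨b, rfl⟩ := cover_surjective (k := k) b₀
  have hN : 0 < N := by omega
  obtain ⟨T, hT, -⟩ := hA N (k * N) hN3 (hN3.trans (Nat.le_mul_of_pos_left N hk)) (fibre N k)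
    (fibre_injective hN) b (fun i hi => (hb₀ 0).1 (by rw [← hi, cover_fibre]; rfl))
  rcases A.isLift_run_or_wrong_mark hN hk hb₀ T with h | ⟨l, hl, hbl⟩
  · rw [h.marked] at hT
    have : b.link Dir.north ∈ b.incidentLinks := Finset.mem_insert_self _ _
    rw [← hT] at this
    exact Finset.notMem_empty _ this
  · rw [hT] at hl
    exact hbl (Node.mem_of_mem_incidentLinks hl)

end Automaton

end BlackHole

theorem mainTheorem1 (k t : ℕ) :
    ¬ ∃ (S : Type*) (_ : Finite S) (A : BlackHole.Automaton S), A.SolvesBHS k t := by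
  rintro ⟨S, _, A, hA⟩
  exact A.not_solvesBHS k t hA
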